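/- Let $0<\alpha<1$. For $n\ge 2$ let $E_n=\{\frac{2k-n-1}{n-1} : k=1,\dots,n\}$ be the $n$-grid in $[-1,1]$, and for a set $K\subset\mathbb R$ and a polynomial $p$ write $\|p\|_K=\sup_{x\in K}|p(x)|$. For each $n\ge 2$ let $p_n^*$ be an extremal polynomial, i.e. a polynomial (with real or complex coefficients), not identically zero and of degree at most $\alpha n$, such that $$\frac{\|p_n^*\|_{[-1,1]}}{\|p_n^*\|_{E_n}}=\sup_{p\not\equiv 0,\ \deg p\le \alpha n}\frac{\|p\|_{[-1,1]}}{\|p\|_{E_n}},$$ where $p$ ranges over polynomials over the same field as $p_n^*$. Let $d\sigma=\frac12\chi_{[-1,1]}(x)\,dx$, and let $\mathcal M_{\alpha,\sigma}$ be the set of positive Borel measures $\mu$ on $\mathbb R$ with $\int d\mu=\alpha$ and $\mu\le\sigma$. For $\mu\in\mathcal M_{\alpha,\sigma}$ put $$U^\mu(x)=\int\log\frac1{|x-y|}\,d\mu(y),\qquad J(\mu)=\min_{x\in\operatorname{supp}(\sigma-\mu)}U^\mu(x)-\min_{x\in[-1,1]}U^\mu(x).$$ Then $$\limsup_{n\to\infty}\frac1n\log\frac{\|p_n^*\|_{[-1,1]}}{\|p_n^*\|_{E_n}}\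 \le\ \sup_{\mu\in\mathcal M_{\alpha,\sigma}}J(\mu).$$ -/

import Mathlib

open MeasureTheory Filter Polynomial
open scoped ENNReal

namespace GridPoly

noncomputable section

/-- The `n`-grid: the equally spaced points `(2k - n - 1)/(n - 1)`, `k = 1, …, n`
(meaningful for `n ≥ 2`). -/
def grid (n : ℕ) : Set ℝ :=
  {x | ∃ k : ℕ, 1 ≤ k ∧ k ≤ n ∧ x = (2 * (k : ℝ) - n - 1) / ((n : ℝ) - 1)}

/-- The uniform norm of the polynomial `p` over the set `K` of real points. -/
def supNorm {𝕜 : Type*} [RCLike 𝕜] (K : Set ℝ) (p : 𝕜[X]) : ℝ :=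
  sSup ((fun x : ℝ => ‖p.eval (x : 𝕜)‖) '' K)

/-- The ratio of the uniform norms over `[-1,1]` and over the `n`-grid. -/
def normRatio {𝕜 : Type*} [RCLike 𝕜] (n : ℕ) (p : 𝕜[X]) : ℝ :=
  supNorm (Set.Icc (-1) 1) p / supNorm (grid n) p

/-- The polynomials of degree at most `α n` that do not vanish identically. -/
def admissible (𝕜 : Type*) [RCLike 𝕜] (α : ℝ) (n : ℕ) : Set 𝕜[X] :=
  {p | p ≠ 0 ∧ (p.natDegree : ℝ) ≤ α * n}

/-- `p` is an extremal polynomial: it is admissible and its norm ratio is the supremum of the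
norm ratios of all admissible polynomials. -/
def IsExtremal {𝕜 : Type*} [RCLike 𝕜] (α : ℝ) (n : ℕ) (p : 𝕜[X]) : Prop :=
  p ∈ admissible 𝕜 α n ∧ IsLUB (normRatio n '' admissible 𝕜 α n) (normRatio n p)

/-- The measure `dσ = (1/2) χ_{[-1,1]} dx`. -/
def sigma : Measure ℝ := (2⁻¹ : ℝ≥0∞) • volume.restrict (Set.Icc (-1) 1)

/-- The positive measures of total mass `α` that are bounded above by `σ`. -/
def classM (α : ℝ) : Set (Measure ℝ) :=
  {μ | μ Set.univ = ENNReal.ofReal α ∧ μ ≤ sigma}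

/-- The logarithmic potential `U^μ(x) = ∫ log (1/|x - y|) dμ(y)` on the real line. For `μ ≤ σ`
the integral converges, and the value of the integrand at `y = x` is irrelevant because `μ` has
no atoms. -/
def logPotential (μ : Measure ℝ) (x : ℝ) : ℝ :=
  ∫ y, Real.log (1 / |x - y|) ∂μ

/-- The functional `J(μ) = min_{supp(σ-μ)} U^μ - min_{[-1,1]} U^μ`. For `μ ≤ σ` with `μ ≠ σ` the
potential is continuous and both sets are compact and non-empty, so the infima are minima. -/
def J (μ : Measure ℝ) : ℝ :=
  sInf (logPotential μ '' (sigma - μ).support) - sInf (logPotential μ '' Set.Icc (-1) 1)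

end

end GridPoly

/-! Discretize the measure. For fixed `n`, let `m = ⌊αn⌋` and take `m + 1` grid points maximizing
the product of mutual distances, with `a` the point whose distances to the others have the least
product, `exp V` (`exists_fekete`). Interpolating `p` at these points (`norm_eval_le_sum_prod`)
leaves denominators at least `exp V`. Let `μ` be `σ` on the cells of the chosen points, with the
cell of `a` filled only partially so that the mass is exactly `α`. Comparing sums over nodes with
integrals over cells costs `O(log n)`. Hence the numerators at `x` are at most `exp (-n U^μ(x) +
O(log n))`. A point of `supp (σ - μ)` lies in the cell of an unchosen node or of `a`; since
exchanging `a` for an unchosen node does not pay, `n U^μ ≥ -V - O(log n)` there. Together these give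
`exp (n J(μ) + O(log n))`, and the error vanishes after division by `n`. -/

namespace GridPoly

/-! ### Integrals of the logarithmic kernel over intervals -/

section LogIntegrals

theorem integrableOn_log_sub (x a b : ℝ) :
    IntegrableOn (fun z => Real.log (x - z)) (Set.Ioc a b) := by
  have h : IntervalIntegrable (fun z => Real.log (x - z)) volume a b := by
    have h := (intervalIntegral.intervalIntegrable_log' (a := x - a) (b := x - b)).comp_sub_left x
    simpa using h
  exact h.1

theorem setIntegral_log_sub_le {x a b c : ℝ} (hab : a ≤ b)
    (h : ∀ z ∈ Set.Ioc a b, z ≠ x → Real.log (x - z) ≤ c) :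
    ∫ z in Set.Ioc a b, Real.log (x - z) ≤ c * (b - a) := by
  calc ∫ z in Set.Ioc a b, Real.log (x - z) ≤ ∫ z in Set.Ioc a b, c := by
        refine setIntegral_mono_on_ae (integrableOn_log_sub x a b) (by simp) measurableSet_Ioc ?_
        filter_upwards [compl_mem_ae_iff.mpr (measure_singleton x)] with z hz hz'
        exact h z hz' hz
    _ = c * (b - a) := by
        simp [hab, mul_comm]

theorem le_setIntegral_log_sub {x a b c : ℝ} (hab : a ≤ b)
    (h : ∀ z ∈ Set.Ioc a b, z ≠ x → c ≤ Real.log (x - z)) :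
    c * (b - a) ≤ ∫ z in Set.Ioc a b, Real.log (x - z) := by
  calc c * (b - a) = ∫ z in Set.Ioc a b, c := by
        simp [hab, mul_comm]
    _ ≤ ∫ z in Set.Ioc a b, Real.log (x - z) := by
        refine setIntegral_mono_on_ae (by simp) (integrableOn_log_sub x a b) measurableSet_Ioc ?_
        filter_upwards [compl_mem_ae_iff.mpr (measure_singleton x)] with z hz hz'
        exact h z hz' hz

/-- The function `log r - log |x - z|` is positive only for `|x - z| < r`, where its integral is
`2r`. The bound is thus uniform in the position of `x`, even inside the interval. -/
theorem log_mul_sub_le_setIntegral_log_sub {x a b r : ℝ} (hab : a ≤ b) (hr : 0 < r) :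
    Real.log r * (b - a) - 2 * r ≤ ∫ z in Set.Ioc a b, Real.log (x - z) := by
  set I := Set.Ioc (x - r) (x + r)
  set g : ℝ → ℝ := I.indicator (fun z => Real.log r - Real.log (x - z)) with hg
  have hgi : Integrable g := by
    rw [hg, integrable_indicator_iff measurableSet_Ioc]
    exact Integrable.sub (by simp) (integrableOn_log_sub x _ _)
  have hint : ∫ z, g z = 2 * r := by
    have hle : x - r ≤ x + r := by linarith
    rw [hg, integral_indicator measurableSet_Ioc, integral_sub (by simp)
      (integrableOn_log_sub x _ _), ← intervalIntegral.integral_of_le hle,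
      ← intervalIntegral.integral_of_le hle,
      intervalIntegral.integral_comp_sub_left (fun z => Real.log z), integral_log]
    have : x - (x + r) = -r := by ring
    simp [this]
    ring
  have hg0 : 0 ≤ᵐ[volume] g := by
    filter_upwards [compl_mem_ae_iff.mpr (measure_singleton x)] with z hz
    simp only [hg, Pi.zero_apply]
    refine Set.indicator_apply_nonneg fun hzI => ?_
    have hz : x - z ≠ 0 := sub_ne_zero.mpr (Ne.symm hz)
    rw [sub_nonneg, ← Real.log_abs]
    refine Real.log_le_log (abs_pos.mpr hz) (abs_le.mpr ⟨?_, ?_⟩) <;> linarith [hzI.1, hzI.2]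
  have h1 : ∫ z in Set.Ioc a b, (Real.log r - Real.log (x - z)) ≤ ∫ z in Set.Ioc a b, g z := by
    refine setIntegral_mono_on (Integrable.sub (by simp) (integrableOn_log_sub x _ _))
      hgi.integrableOn measurableSet_Ioc fun z _ => ?_
    by_cases hz : z ∈ I
    · simp [hg, hz]
    · simp only [hg, Set.indicator_of_notMem hz, sub_nonpos]
      rw [← Real.log_abs (x - z)]
      refine Real.log_le_log hr ?_
      simp only [I, Set.mem_Ioc, not_and_or, not_lt, not_le] at hz
      rcases hz with hz | hz
      · exact le_abs.mpr (Or.inl (by linarith))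
      · exact le_abs.mpr (Or.inr (by linarith))
  have h2 := setIntegral_le_integral (s := Set.Ioc a b) hgi hg0
  rw [integral_sub (by simp) (integrableOn_log_sub x _ _)] at h1
  simp only [integral_const, MeasurableSet.univ, measureReal_restrict_apply, Set.univ_inter,
    Real.volume_real_Ioc_of_le hab, smul_eq_mul] at h1
  linarith [mul_comm (b - a) (Real.log r)]

end LogIntegrals

/-! ### Comparison of grid points with cell averages -/

section Cells

/-- The `k`-th point of the `n`-grid, counted from `0`. -/
noncomputable def node (n k : ℕ) : ℝ := -1 + 2 * k / ((n : ℝ) - 1)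

/-- The left portion of relative length `θ` of the `k`-th of the `n` equal cells of `[-1,1]`. -/
def piece (n k : ℕ) (θ : ℝ) : Set ℝ := Set.Ioc (-1 + 2 * k / (n : ℝ)) (-1 + 2 * (k + θ) / (n : ℝ))

/-- The `k`-th of the `n` equal closed cells of `[-1,1]`. -/
def cell (n k : ℕ) : Set ℝ := Set.Icc (-1 + 2 * k / (n : ℝ)) (-1 + 2 * (k + 1) / (n : ℝ))

/-- The normalized integral of `log |x - ·|` over a piece of a cell. -/
noncomputable def logAvg (n k : ℕ) (θ x : ℝ) : ℝ := n / 2 * ∫ z in piece n k θ, Real.log (x - z)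

variable {n k j : ℕ} {θ x : ℝ}

theorem piece_le (hn : 2 ≤ n) (h0 : 0 ≤ θ) :
    -1 + 2 * k / (n : ℝ) ≤ -1 + 2 * (k + θ) / (n : ℝ) := by
  gcongr; linarith

theorem piece_subset_cell (h1 : θ ≤ 1) : piece n k θ ⊆ cell n k := by
  refine fun z hz => ⟨hz.1.le, hz.2.trans ?_⟩
  gcongr

theorem cell_subset_Icc (hk : k < n) : cell n k ⊆ Set.Icc (-1) 1 := by
  have hn : (0 : ℝ) < n := by exact_mod_cast (by omega : 0 < n)
  refine fun z hz => ⟨le_trans ?_ hz.1, hz.2.trans ?_⟩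
  · have : 0 ≤ 2 * (k : ℝ) / n := by positivity
    linarith
  · have : (k : ℝ) + 1 ≤ n := by exact_mod_cast hk
    have : 2 * ((k : ℝ) + 1) / n ≤ 2 := by rw [div_le_iff₀ hn]; linarith
    linarith

theorem node_mem_cell (hn : 2 ≤ n) (hk : k < n) : node n k ∈ cell n k := by
  have hn : (2 : ℝ) ≤ n := by exact_mod_cast hn
  have hk : (k : ℝ) + 1 ≤ n := by exact_mod_cast hk
  constructor
  · unfold node; gcongr <;> linarith
  · unfold node
    have : 2 * (k : ℝ) / (n - 1) ≤ 2 * (k + 1) / n := by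
      rw [div_le_div_iff₀ (by linarith) (by linarith)]; nlinarith
    linarith

theorem exists_mem_cell (hn : 2 ≤ n) (hx : x ∈ Set.Icc (-1 : ℝ) 1) : ∃ j < n, x ∈ cell n j := by
  have hn0 : (0 : ℝ) < n := by exact_mod_cast (by omega : 0 < n)
  rcases eq_or_lt_of_le hx.2 with rfl | h1
  · refine ⟨n - 1, by omega, ?_⟩
    rw [cell, Nat.cast_sub (by omega)]
    constructor
    · have : 2 * ((n : ℝ) - 1) / n ≤ 2 := by rw [div_le_iff₀ hn0]; linarith
      push_cast
      linarith
    · push_cast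
      have : 2 * ((n : ℝ) - 1 + 1) / n = 2 := by field_simp; ring
      linarith
  · have hy : 0 ≤ (x + 1) / 2 * n := mul_nonneg (by linarith [hx.1]) hn0.le
    refine ⟨⌊(x + 1) / 2 * n⌋₊, ?_, ?_, ?_⟩
    · rw [Nat.floor_lt hy]; nlinarith
    · have h := Nat.floor_le hy
      have : 2 * (⌊(x + 1) / 2 * n⌋₊ : ℝ) / n ≤ x + 1 := by rw [div_le_iff₀ hn0]; linarith
      linarith
    · have h := (Nat.lt_floor_add_one ((x + 1) / 2 * n)).le
      have : x + 1 ≤ 2 * ((⌊(x + 1) / 2 * n⌋₊ : ℝ) + 1) / n := by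
        rw [le_div_iff₀ hn0]; linarith
      linarith

theorem dist_nat_ge_one (h : k ≠ j) : (1 : ℝ) ≤ |(k : ℝ) - j| := by
  have : (1 : ℤ) ≤ |(k : ℤ) - j| := Int.one_le_abs (sub_ne_zero.mpr (by exact_mod_cast h))
  exact_mod_cast this

theorem node_sub_node : node n j - node n k = 2 / ((n : ℝ) - 1) * (j - k) := by
  unfold node; ring

theorem abs_node_sub_node_ge (hn : 2 ≤ n) :
    2 / (n : ℝ) * |(k : ℝ) - j| ≤ |node n j - node n k| := by
  have hn : (2 : ℝ) ≤ n := by exact_mod_cast hn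
  have h1 : 0 < (n : ℝ) - 1 := by linarith
  rw [node_sub_node, abs_mul, abs_of_pos (by positivity : 0 < 2 / ((n : ℝ) - 1)), abs_sub_comm]
  gcongr
  linarith

theorem node_injective (hn : 2 ≤ n) : Function.Injective (node n) := by
  intro j k h
  by_contra hne
  have hn' : (0 : ℝ) < n := by exact_mod_cast (by omega : 0 < n)
  have h1 := abs_node_sub_node_ge (k := k) (j := j) hn
  rw [h, sub_self, abs_zero] at h1
  have h2 := dist_nat_ge_one (Ne.symm hne)
  have : 0 < 2 / (n : ℝ) * |(k : ℝ) - j| := by positivity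
  linarith

theorem logAvg_le {c : ℝ} (hn : 2 ≤ n) (h0 : 0 ≤ θ)
    (h : ∀ z ∈ piece n k θ, z ≠ x → Real.log (x - z) ≤ c) : logAvg n k θ x ≤ c * θ := by
  have hn0 : (0 : ℝ) < n := by exact_mod_cast (by omega : 0 < n)
  have := setIntegral_log_sub_le (piece_le hn h0) h
  calc logAvg n k θ x ≤ n / 2 * (c * (-1 + 2 * (k + θ) / (n : ℝ) - (-1 + 2 * k / (n : ℝ)))) := by
        unfold logAvg; gcongr; exact this
    _ = c * θ := by field_simp; ring

theorem le_logAvg {c : ℝ} (hn : 2 ≤ n) (h0 : 0 ≤ θ)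
    (h : ∀ z ∈ piece n k θ, z ≠ x → c ≤ Real.log (x - z)) : c * θ ≤ logAvg n k θ x := by
  have hn0 : (0 : ℝ) < n := by exact_mod_cast (by omega : 0 < n)
  have := le_setIntegral_log_sub (piece_le hn h0) h
  calc c * θ = n / 2 * (c * (-1 + 2 * (k + θ) / (n : ℝ) - (-1 + 2 * k / (n : ℝ)))) := by
        field_simp; ring
    _ ≤ logAvg n k θ x := by unfold logAvg; gcongr; exact this

theorem neg_log_le_logAvg (hn : 2 ≤ n) (h0 : 0 ≤ θ) (h1 : θ ≤ 1) :
    -(Real.log n + 1) ≤ logAvg n k θ x := by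
  have hn0 : (0 : ℝ) < n := by exact_mod_cast (by omega : 0 < n)
  have hlog : 0 ≤ Real.log n := Real.log_natCast_nonneg n
  have := log_mul_sub_le_setIntegral_log_sub (x := x) (piece_le (k := k) hn h0)
    (inv_pos.mpr hn0)
  calc -(Real.log n + 1) ≤ -(Real.log n * θ + 1) := by nlinarith
    _ = n / 2 * (Real.log (n : ℝ)⁻¹ * (-1 + 2 * (k + θ) / (n : ℝ) - (-1 + 2 * k / (n : ℝ)))
          - 2 * (n : ℝ)⁻¹) := by
        rw [Real.log_inv]; field_simp; ring
    _ ≤ logAvg n k θ x := by unfold logAvg; gcongr; exact this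

theorem log_sub_le_log_two {y z : ℝ} (hy : y ∈ Set.Icc (-1 : ℝ) 1) (hz : z ∈ Set.Icc (-1 : ℝ) 1) :
    Real.log (y - z) ≤ Real.log 2 := by
  rcases eq_or_ne y z with rfl | hne
  · simpa using Real.log_nonneg one_le_two
  · rw [← Real.log_abs]
    refine Real.log_le_log (abs_pos.mpr (sub_ne_zero.mpr hne)) (abs_le.mpr ⟨?_, ?_⟩) <;>
      linarith [hy.1, hy.2, hz.1, hz.2]

theorem logAvg_le_log_two (hn : 2 ≤ n) (hk : k < n) (h0 : 0 ≤ θ) (h1 : θ ≤ 1)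
    (hx : x ∈ Set.Icc (-1 : ℝ) 1) : logAvg n k θ x ≤ Real.log 2 := by
  refine (logAvg_le hn h0 fun z hz _ =>
    log_sub_le_log_two hx (cell_subset_Icc hk (piece_subset_cell h1 hz))).trans ?_
  exact mul_le_of_le_one_right (Real.log_nonneg one_le_two) h1

theorem abs_sub_le_of_mem_cell {y z : ℝ} (hy : y ∈ cell n k) (hz : z ∈ cell n k) :
    |y - z| ≤ 2 / n := by
  have : 2 * ((k : ℝ) + 1) / n = 2 * k / n + 2 / n := by ring
  rw [abs_le]
  constructor <;> linarith [hy.1, hy.2, hz.1, hz.2]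

theorem abs_sub_ge_of_mem_cell {y z : ℝ} (hy : y ∈ cell n j) (hz : z ∈ cell n k) :
    2 / n * (|(k : ℝ) - j| - 1) ≤ |y - z| := by
  have h1 : ∀ i : ℕ, 2 * ((i : ℝ) + 1) / n = 2 / n * i + 2 / n := fun i => by ring
  have h2 : ∀ i : ℕ, 2 * (i : ℝ) / n = 2 / n * i := fun i => by ring
  have hy1 := hy.1; have hy2 := hy.2; have hz1 := hz.1; have hz2 := hz.2
  rw [h1] at hy2 hz2
  rw [h2] at hy1 hz1
  rcases abs_cases ((k : ℝ) - j) with ⟨h, -⟩ | ⟨h, -⟩ <;> rw [h]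
  · exact le_abs.mpr (Or.inr (by linarith))
  · exact le_abs.mpr (Or.inl (by linarith))

/-- Displacing points by `O(1/n)` when they are about `|k - j|/n` apart changes the logarithm by
`O(1/|k - j|)`, which sums to `O(log n)`. -/
theorem log_le_log_add_div {a b c : ℝ} (ha : 0 < a) (hb : 0 < b) (h : a ≤ b + c) :
    Real.log a ≤ Real.log b + c / b := by
  have h1 : a / b ≤ 1 + c / b := by rw [div_le_iff₀ hb]; field_simp; exact h
  have h2 := Real.log_le_sub_one_of_pos (div_pos ha hb)
  rw [Real.log_div ha.ne' hb.ne'] at h2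
  linarith

theorem logAvg_le_log_node_sub (hn : 2 ≤ n) (hk : k < n) (hj : j < n) (hkj : k ≠ j)
    (hx : x ∈ cell n j) :
    logAvg n k 1 x ≤ Real.log (node n j - node n k) + 2 / |(k : ℝ) - j| := by
  have hn0 : (0 : ℝ) < n := by exact_mod_cast (by omega : 0 < n)
  have hd := dist_nat_ge_one hkj
  have hge := abs_node_sub_node_ge (k := k) (j := j) hn
  have hpos : 0 < |node n j - node n k| := lt_of_lt_of_le (by positivity) hge
  rw [← mul_one (_ + _)]
  refine logAvg_le hn zero_le_one fun z hz hzx => ?_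
  have h1 := abs_sub_le_of_mem_cell hx (node_mem_cell hn hj)
  have h2 := abs_sub_le_of_mem_cell (node_mem_cell hn hk) (piece_subset_cell le_rfl hz)
  have h3 : |x - z| ≤ |node n j - node n k| + 4 / n := by
    have e : x - z = (x - node n j) + (node n j - node n k) + (node n k - z) := by ring
    have e2 : (4 : ℝ) / n = 2 / n + 2 / n := by ring
    rw [e, e2]
    linarith [abs_add_three (x - node n j) (node n j - node n k) (node n k - z)]
  have h4 := log_le_log_add_div (abs_pos.mpr (sub_ne_zero.mpr (Ne.symm hzx))) hpos h3
  rw [Real.log_abs, Real.log_abs] at h4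
  refine h4.trans ?_
  have : 4 / (n : ℝ) / |node n j - node n k| ≤ 2 / |(k : ℝ) - j| := by
    rw [div_le_div_iff₀ hpos (by linarith)]
    calc 4 / (n : ℝ) * |(k : ℝ) - j| = 2 * (2 / (n : ℝ) * |(k : ℝ) - j|) := by ring
      _ ≤ _ := by linarith
  linarith

/-- For `|k - j| ≤ 1` no comparison is possible, as `x` may lie in or next to the cell; the crude
bounds `log 2` and `-(log n + 1)` are used, for at most three cells. -/
theorem abs_sub_node_le_exp (hn : 2 ≤ n) (hk : k < n) (hj : j < n) (hx : x ∈ cell n j) :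
    |x - node n k| ≤ Real.exp (logAvg n k 1 x + (2 / |(k : ℝ) - j| +
      if |(k : ℝ) - j| ≤ 1 then Real.log n + 1 + Real.log 2 else 0)) := by
  have hn0 : (0 : ℝ) < n := by exact_mod_cast (by omega : 0 < n)
  have hx1 := cell_subset_Icc hj hx
  have hk1 := cell_subset_Icc hk (node_mem_cell hn hk)
  have hnn : 0 ≤ 2 / |(k : ℝ) - j| := by positivity
  rcases eq_or_ne (x - node n k) 0 with h0 | h0
  · rw [h0, abs_zero]; positivity
  rw [← Real.exp_log (abs_pos.mpr h0), Real.exp_le_exp, Real.log_abs]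
  split_ifs with h
  · linarith [log_sub_le_log_two hx1 hk1, neg_log_le_logAvg (k := k) (x := x) hn zero_le_one le_rfl]
  · have hd : (2 : ℝ) ≤ |(k : ℝ) - j| := by
      have h' : (1 : ℤ) < |(k : ℤ) - j| := by
        have := not_le.mp h
        exact_mod_cast this
      have h'' : (2 : ℤ) ≤ |(k : ℤ) - j| := h'
      exact_mod_cast h''
    rw [add_zero, ← sub_le_iff_le_add, ← mul_one (_ - _)]
    refine le_logAvg hn zero_le_one fun z hz hzx => ?_
    have hz := piece_subset_cell le_rfl hz
    have h2 := abs_sub_le_of_mem_cell hz (node_mem_cell hn hk)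
    have h3 := abs_sub_ge_of_mem_cell hx hz
    have hp : 0 < |x - z| := abs_pos.mpr (sub_ne_zero.mpr (Ne.symm hzx))
    have h4 : |x - node n k| ≤ |x - z| + 2 / n := by
      have := abs_add_le (x - z) (z - node n k)
      rw [sub_add_sub_cancel] at this
      linarith
    have h5 := log_le_log_add_div (abs_pos.mpr h0) hp h4
    rw [Real.log_abs, Real.log_abs] at h5
    have : 2 / (n : ℝ) / |x - z| ≤ 2 / |(k : ℝ) - j| := by
      rw [div_le_div_iff₀ hp (by linarith)]
      -- For `d ≥ 2` one has `d ≤ 2 (d - 1)`.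
      have : 2 / (n : ℝ) * |(k : ℝ) - j| ≤ 2 * (2 / n * (|(k : ℝ) - j| - 1)) := by
        rw [mul_left_comm]; gcongr; linarith
      linarith
    linarith

theorem sum_inv_abs_sub_le (S : Finset ℕ) (hS : S ⊆ Finset.range n) (hj : j < n) :
    ∑ k ∈ S, 2 / |(k : ℝ) - j| ≤ 4 * (Real.log n + 1) := by
  have hH : ∑ i ∈ Finset.range n, 2 * ((i : ℝ) + 1)⁻¹ ≤ 2 * (Real.log n + 1) := by
    have := harmonic_le_one_add_log n
    rw [harmonic] at this
    push_cast at this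
    rw [← Finset.mul_sum]
    linarith
  have hnn : ∀ i ∈ Finset.range n, 0 ≤ 2 * ((i : ℝ) + 1)⁻¹ := fun i _ => by positivity
  have hlt : ∑ k ∈ Finset.range j, 2 / |(k : ℝ) - j| ≤ 2 * (Real.log n + 1) := by
    refine le_trans (le_of_eq ?_) ((Finset.sum_le_sum_of_subset_of_nonneg
      (Finset.range_subset_range.mpr hj.le) fun i hi _ => hnn i hi).trans hH)
    rw [← Finset.sum_range_reflect]
    refine Finset.sum_congr rfl fun k hk => ?_
    have hk := Finset.mem_range.mp hk
    rw [div_eq_mul_inv, Nat.cast_sub (by omega), Nat.cast_sub (by omega)]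
    push_cast
    congr 2
    rw [abs_of_nonpos (by linarith)]
    ring
  have hge : ∑ k ∈ Finset.range n \ Finset.range (j + 1), 2 / |(k : ℝ) - j|
      ≤ 2 * (Real.log n + 1) := by
    refine le_trans ?_ hH
    have hIco : Finset.range n \ Finset.range (j + 1) = Finset.Ico (j + 1) n := by
      ext; simp; omega
    rw [hIco, Finset.sum_Ico_eq_sum_range]
    refine le_trans (le_of_eq ?_) (Finset.sum_le_sum_of_subset_of_nonneg
      (Finset.range_subset_range.mpr (Nat.sub_le n (j + 1))) fun i hi _ => hnn i hi)
    refine Finset.sum_congr rfl fun k _ => ?_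
    rw [div_eq_mul_inv]
    congr 2
    push_cast
    rw [abs_of_nonneg (by linarith)]
    ring
  have hsub := Finset.sum_le_sum_of_subset_of_nonneg (f := fun k : ℕ => 2 / |(k : ℝ) - j|) hS
    fun i _ _ => by positivity
  refine hsub.trans ?_
  rw [← Finset.sum_sdiff (Finset.range_subset_range.mpr (Nat.succ_le_of_lt hj)),
    Finset.sum_range_succ]
  -- The term `k = j` is `2 / 0 = 0`.
  simp only [sub_self, abs_zero, div_zero, add_zero]
  linarith

theorem sum_near_le (S : Finset ℕ) {c : ℝ} (hc : 0 ≤ c) :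
    ∑ k ∈ S, (if |(k : ℝ) - j| ≤ 1 then c else 0) ≤ 3 * c := by
  rw [← Finset.sum_filter, Finset.sum_const, nsmul_eq_mul]
  gcongr
  have hsub : S.filter (fun k : ℕ => |(k : ℝ) - j| ≤ 1) ⊆ Finset.Icc (j - 1) (j + 1) := by
    intro k hk
    have hk : |(k : ℤ) - j| ≤ 1 := by exact_mod_cast (Finset.mem_filter.mp hk).2
    rw [abs_le] at hk
    rw [Finset.mem_Icc]
    omega
  have := Finset.card_le_card hsub
  rw [Nat.card_Icc] at this
  exact_mod_cast this.trans (by omega)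

theorem prod_abs_sub_node_le_exp (S : Finset ℕ) (hn : 2 ≤ n) (hS : S ⊆ Finset.range n)
    (hx : x ∈ Set.Icc (-1 : ℝ) 1) :
    ∏ k ∈ S, |x - node n k| ≤
      Real.exp (∑ k ∈ S, logAvg n k 1 x + 10 * (Real.log n + 1)) := by
  obtain ⟨j, hj, hxj⟩ := exists_mem_cell hn hx
  have hlog : 0 ≤ Real.log n := Real.log_natCast_nonneg n
  have hl2 : Real.log 2 ≤ 1 := by linarith [Real.log_two_lt_d9]
  have hl2' : 0 ≤ Real.log 2 := Real.log_nonneg one_le_two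
  calc ∏ k ∈ S, |x - node n k|
      ≤ ∏ k ∈ S, Real.exp (logAvg n k 1 x + (2 / |(k : ℝ) - j| +
          if |(k : ℝ) - j| ≤ 1 then Real.log n + 1 + Real.log 2 else 0)) :=
        Finset.prod_le_prod (fun _ _ => abs_nonneg _) fun k hk =>
          abs_sub_node_le_exp hn (Finset.mem_range.mp (hS hk)) hj hxj
    _ ≤ _ := by
        rw [← Real.exp_sum, Real.exp_le_exp, Finset.sum_add_distrib, Finset.sum_add_distrib]
        have h1 := sum_inv_abs_sub_le S hS hj
        have h2 := sum_near_le (j := j) S (by positivity : 0 ≤ Real.log n + 1 + Real.log 2)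
        linarith

end Cells

/-! ### Measures filling selected cells -/

section GridMeasure

variable {n : ℕ} {S : Finset ℕ} {w : ℕ → ℝ} {x : ℝ}

/-- The restriction of `σ` to the pieces of relative lengths `w k` of the cells indexed by `S`. -/
noncomputable def gridMeasure (n : ℕ) (S : Finset ℕ) (w : ℕ → ℝ) : Measure ℝ :=
  (2⁻¹ : ℝ≥0∞) • volume.restrict (⋃ k ∈ S, piece n k (w k))

theorem pairwise_disjoint_piece (hw1 : ∀ k ∈ S, w k ≤ 1) :
    Set.Pairwise (S : Set ℕ) (Function.onFun Disjoint fun k => piece n k (w k)) := by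
  have key : ∀ k ∈ S, ∀ l, k < l → Disjoint (piece n k (w k)) (piece n l (w l)) := by
    intro k hk l hkl
    rw [Set.disjoint_left]
    intro z hz hz'
    have h1 := (piece_subset_cell (hw1 k hk) hz).2
    have h2 := hz'.1
    have h3 : (k : ℝ) + 1 ≤ l := by exact_mod_cast hkl
    have h4 : 2 * ((k : ℝ) + 1) / n ≤ 2 * l / n := by gcongr
    linarith
  intro k hk l hl hkl
  rcases lt_or_gt_of_ne hkl with h | h
  · exact key k hk l h
  · exact (key l hl k h).symm

theorem volume_piece {k : ℕ} {θ : ℝ} : volume (piece n k θ) = ENNReal.ofReal (2 * θ / n) := by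
  rw [piece, Real.volume_Ioc]
  congr 1
  ring

theorem gridMeasure_univ (hw0 : ∀ k ∈ S, 0 ≤ w k) (hw1 : ∀ k ∈ S, w k ≤ 1) :
    gridMeasure n S w Set.univ = ENNReal.ofReal ((∑ k ∈ S, w k) / n) := by
  rw [gridMeasure, Measure.smul_apply, Measure.restrict_apply_univ,
    measure_biUnion_finset (pairwise_disjoint_piece hw1) fun _ _ => measurableSet_Ioc]
  simp_rw [volume_piece]
  rw [← ENNReal.ofReal_sum_of_nonneg fun k hk => by have := hw0 k hk; positivity, smul_eq_mul,
    ← ENNReal.ofReal_ofNat 2, ← ENNReal.ofReal_inv_of_pos two_pos,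
    ← ENNReal.ofReal_mul (by positivity), ← Finset.sum_div, ← Finset.mul_sum]
  congr 1
  ring

theorem iUnion_piece_subset (hS : S ⊆ Finset.range n) (hw1 : ∀ k ∈ S, w k ≤ 1) :
    ⋃ k ∈ S, piece n k (w k) ⊆ Set.Icc (-1 : ℝ) 1 :=
  Set.iUnion₂_subset fun k hk =>
    (piece_subset_cell (hw1 k hk)).trans (cell_subset_Icc (Finset.mem_range.mp (hS hk)))

theorem gridMeasure_le_sigma (hS : S ⊆ Finset.range n) (hw1 : ∀ k ∈ S, w k ≤ 1) :
    gridMeasure n S w ≤ sigma := by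
  refine Measure.le_iff.mpr fun t _ => ?_
  simp only [gridMeasure, sigma, Measure.smul_apply, smul_eq_mul]
  gcongr
  exact iUnion_piece_subset hS hw1

theorem natCast_mul_logPotential_gridMeasure (hw1 : ∀ k ∈ S, w k ≤ 1) :
    n * logPotential (gridMeasure n S w) x = -∑ k ∈ S, logAvg n k (w k) x := by
  have h : ∀ y : ℝ, Real.log (1 / |x - y|) = -Real.log (x - y) := fun y => by
    rw [one_div, Real.log_inv, Real.log_abs]
  simp_rw [logPotential, h]
  rw [gridMeasure, integral_smul_measure, integral_neg,
    integral_biUnion_finset S (s := fun k => piece n k (w k)) (fun _ _ => measurableSet_Ioc)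
      (pairwise_disjoint_piece hw1) fun k _ => integrableOn_log_sub x _ _]
  simp only [logAvg, ← Finset.mul_sum, ENNReal.toReal_inv, ENNReal.toReal_ofNat, smul_eq_mul]
  ring

instance isFiniteMeasure_sigma : IsFiniteMeasure sigma := by
  refine ⟨?_⟩
  rw [sigma, Measure.smul_apply, Measure.restrict_apply_univ, Real.volume_Icc, smul_eq_mul]
  exact ENNReal.mul_lt_top (by simp) ENNReal.ofReal_lt_top

theorem sigma_univ : sigma Set.univ = 1 := by
  rw [sigma, Measure.smul_apply, Measure.restrict_apply_univ, Real.volume_Icc, smul_eq_mul]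
  norm_num
  exact ENNReal.inv_mul_cancel (by simp) (by simp)

theorem nonempty_support_sigma_sub {μ : Measure ℝ} (hμ : μ ≤ sigma) (h1 : μ Set.univ < 1) :
    (sigma - μ).support.Nonempty := by
  have : IsFiniteMeasure μ := isFiniteMeasure_of_le sigma hμ
  refine Measure.nonempty_support fun h0 => ?_
  have h2 := Measure.sub_apply MeasurableSet.univ hμ
  rw [h0, sigma_univ, Measure.coe_zero, Pi.zero_apply] at h2
  exact absurd (tsub_eq_zero_iff_le.mp h2.symm) (not_le.mpr h1)

/-- The cells not completely filled form a closed set; off it the two measures differ only by the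
left endpoints of the half-open pieces, a null set. -/
theorem support_sigma_sub_gridMeasure_subset (hn : 2 ≤ n) (hS : S ⊆ Finset.range n)
    (hw1 : ∀ k ∈ S, w k ≤ 1) {y : ℝ} (hy : y ∈ (sigma - gridMeasure n S w).support) :
    ∃ t < n, (t ∉ S ∨ w t ≠ 1) ∧ y ∈ cell n t := by
  classical
  set T := (Finset.range n).filter (fun t => t ∉ S ∨ w t ≠ 1)
  set F := ⋃ t ∈ T, cell n t with hF
  have hFc : IsClosed F := isClosed_biUnion_finset fun _ _ => isClosed_Icc
  have hle := gridMeasure_le_sigma (n := n) hS hw1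
  have : IsFiniteMeasure (gridMeasure n S w) := isFiniteMeasure_of_le sigma hle
  have hmem : F ∈ ae (sigma - gridMeasure n S w) := by
    rw [mem_ae_iff, Measure.sub_apply hFc.measurableSet.compl hle, tsub_eq_zero_iff_le]
    simp only [gridMeasure, sigma, Measure.smul_apply, smul_eq_mul]
    gcongr 1
    rw [Measure.restrict_apply hFc.measurableSet.compl,
      Measure.restrict_apply hFc.measurableSet.compl]
    have hsub : Fᶜ ∩ Set.Icc (-1) 1 ⊆ (Fᶜ ∩ ⋃ k ∈ S, piece n k (w k)) ∪
        (⋃ k ∈ S, {-1 + 2 * (k : ℝ) / n}) := by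
      rintro z ⟨hz, hz1⟩
      obtain ⟨t, ht, hzt⟩ := exists_mem_cell hn hz1
      have hzF : ∀ t ∈ T, z ∉ cell n t := by simpa [hF] using hz
      have htT : t ∉ T := fun h => hzF t h hzt
      have ht' : t ∈ S ∧ w t = 1 := by
        by_contra hcon
        exact htT (Finset.mem_filter.mpr ⟨Finset.mem_range.mpr ht, by tauto⟩)
      rcases eq_or_lt_of_le hzt.1 with h | h
      · exact Or.inr (Set.mem_biUnion ht'.1 h.symm)
      · refine Or.inl ⟨hz, Set.mem_biUnion ht'.1 ⟨h, ?_⟩⟩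
        rw [ht'.2]
        exact hzt.2
    refine (measure_mono hsub).trans ((measure_union_le _ _).trans (le_of_eq ?_))
    have : volume (⋃ k ∈ S, {-1 + 2 * (k : ℝ) / n}) = 0 :=
      (measure_biUnion_null_iff S.countable_toSet).mpr fun k _ => measure_singleton _
    rw [this, add_zero]
  have := Measure.support_subset_of_isClosed hFc hmem hy
  simp only [hF, Set.mem_iUnion] at this
  obtain ⟨t, ht, hyt⟩ := this
  have ht := Finset.mem_filter.mp ht
  exact ⟨t, Finset.mem_range.mp ht.1, ht.2, hyt⟩

end GridMeasure

/-! ### Discrete Fekete sets -/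

section Fekete

/-- A subset of given size that maximizes the sum of a symmetric kernel over its pairs, together
with an element of least partial sum: this element cannot be exchanged profitably. -/
theorem exists_fekete {ι : Type*} [DecidableEq ι] (G : ι → ι → ℝ) (hsymm : ∀ a b, G a b = G b a)
    (hdiag : ∀ a, G a a = 0) (A : Finset ι) {m : ℕ} (hm : m + 1 ≤ A.card) :
    ∃ S ⊆ A, S.card = m + 1 ∧ ∃ a ∈ S,
      (∀ s ∈ S, ∑ u ∈ S.erase a, G a u ≤ ∑ u ∈ S.erase s, G s u) ∧
      ∀ t ∈ A, t ∉ S → ∑ u ∈ S.erase a, G t u ≤ ∑ u ∈ S.erase a, G a u := by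
  obtain ⟨S, hS, hmax⟩ := Finset.exists_max_image (A.powersetCard (m + 1))
    (fun S => ∑ s ∈ S, ∑ u ∈ S, G s u) (Finset.powersetCard_nonempty.mpr hm)
  obtain ⟨hSA, hcard⟩ := Finset.mem_powersetCard.mp hS
  obtain ⟨a, ha, hmin⟩ := Finset.exists_min_image S (fun s => ∑ u ∈ S.erase s, G s u)
    (Finset.card_pos.mp (by omega))
  refine ⟨S, hSA, hcard, a, ha, hmin, fun t htA htS => ?_⟩
  -- Only the interaction of `b` with the remaining points depends on `b`, so maximality compares `b
  -- = t` with `b = a`.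
  have hins : ∀ b ∉ S.erase a, ∑ s ∈ insert b (S.erase a), ∑ u ∈ insert b (S.erase a), G s u =
      ∑ s ∈ S.erase a, ∑ u ∈ S.erase a, G s u + 2 * ∑ u ∈ S.erase a, G b u := by
    intro b hb
    have e : ∑ s ∈ S.erase a, G s b = ∑ s ∈ S.erase a, G b s :=
      Finset.sum_congr rfl fun s _ => hsymm s b
    simp only [Finset.sum_insert hb, Finset.sum_add_distrib, hdiag, e]
    ring
  have ht : t ∉ S.erase a := fun h => htS (Finset.mem_of_mem_erase h)
  have h1 := hins t ht
  have h2 := hins a (Finset.notMem_erase a S)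
  rw [Finset.insert_erase ha] at h2
  have h3 := hmax (insert t (S.erase a)) (Finset.mem_powersetCard.mpr
    ⟨Finset.insert_subset htA ((Finset.erase_subset a S).trans hSA), by
      rw [Finset.card_insert_of_notMem ht, Finset.card_erase_of_mem ha]; omega⟩)
  linarith

end Fekete

/-! ### Lagrange interpolation at grid points -/

section Interpolation

variable {𝕜 : Type*} [RCLike 𝕜] {n : ℕ} {S : Finset ℕ}

theorem finite_grid (n : ℕ) : (grid n).Finite := by
  refine ((Finset.Icc 1 n).finite_toSet.image
    fun k : ℕ => (2 * (k : ℝ) - n - 1) / ((n : ℝ) - 1)).subset ?_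
  rintro x ⟨k, h1, h2, rfl⟩
  exact ⟨k, by simp [h1, h2], rfl⟩

theorem node_mem_grid {k : ℕ} (hn : 2 ≤ n) (hk : k < n) : node n k ∈ grid n := by
  have hn' : (2 : ℝ) ≤ n := by exact_mod_cast hn
  have : (n : ℝ) - 1 ≠ 0 := by linarith
  refine ⟨k + 1, by omega, by omega, ?_⟩
  rw [node]
  push_cast
  field_simp
  ring

theorem norm_eval_le_supNorm_grid (p : 𝕜[X]) {x : ℝ} (hx : x ∈ grid n) :
    ‖p.eval (x : 𝕜)‖ ≤ supNorm (grid n) p :=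
  le_csSup ((finite_grid n).image _).bddAbove ⟨x, hx, rfl⟩

theorem norm_eval_le_sum_prod (hn : 2 ≤ n) (hS : S ⊆ Finset.range n) (p : 𝕜[X])
    (hp : p.natDegree < S.card) (x : ℝ) :
    ‖p.eval (x : 𝕜)‖ ≤ supNorm (grid n) p *
      ∑ s ∈ S, ∏ u ∈ S.erase s, |x - node n u| / |node n s - node n u| := by
  have hinj : Set.InjOn (fun k => (node n k : 𝕜)) S := fun a _ b _ h =>
    node_injective hn (RCLike.ofReal_injective h)
  have hdeg : p.degree < S.card := lt_of_le_of_lt degree_le_natDegree (by exact_mod_cast hp)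
  have h := congrArg (eval (x : 𝕜)) (Lagrange.eq_interpolate hinj hdeg)
  rw [h, Lagrange.interpolate_apply, eval_finsetSum, Finset.mul_sum]
  refine (norm_sum_le _ _).trans (Finset.sum_le_sum fun s hs => ?_)
  rw [eval_mul, eval_C, norm_mul, Lagrange.basis, eval_prod, norm_prod]
  have hev := norm_eval_le_supNorm_grid p (node_mem_grid hn (Finset.mem_range.mp (hS hs)))
  refine mul_le_mul hev (le_of_eq (Finset.prod_congr rfl fun u _ => ?_))
    (Finset.prod_nonneg fun _ _ => norm_nonneg _) ((norm_nonneg _).trans hev)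
  simp only [Lagrange.basisDivisor, eval_mul, eval_C, eval_sub, eval_X, norm_mul, norm_inv,
    ← RCLike.ofReal_sub, RCLike.norm_ofReal]
  rw [div_eq_inv_mul]

theorem supNorm_Icc_pos {p : 𝕜[X]} (hp : p ≠ 0) : 0 < supNorm (Set.Icc (-1) 1) p := by
  have hc : Continuous fun x : ℝ => ‖p.eval (x : 𝕜)‖ :=
    (p.continuous.comp RCLike.continuous_ofReal).norm
  obtain ⟨x, hx, hx0⟩ : ∃ x ∈ Set.Icc (-1 : ℝ) 1, p.eval (x : 𝕜) ≠ 0 := by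
    by_contra! hcon
    refine hp (eq_zero_of_infinite_isRoot p (Set.Infinite.mono ?_
      ((Set.Icc_infinite (by norm_num : (-1 : ℝ) < 1)).image
        (RCLike.ofReal_injective (K := 𝕜)).injOn)))
    rintro _ ⟨x, hx, rfl⟩
    exact hcon x hx
  exact lt_of_lt_of_le (norm_pos_iff.mpr hx0)
    (le_csSup (isCompact_Icc.image hc).bddAbove ⟨x, hx, rfl⟩)

end Interpolation

/-! ### The main estimate and the limit -/

theorem exists_measure_norm_eval_le {α : ℝ} (hα₀ : 0 < α) (hα₁ : α < 1) {n : ℕ} (hn : 2 ≤ n) :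
    ∃ μ ∈ classM α, ∀ (𝕜 : Type*) [RCLike 𝕜] (p : 𝕜[X]), (p.natDegree : ℝ) ≤ α * n →
      ∀ x ∈ Set.Icc (-1 : ℝ) 1, ‖p.eval (x : 𝕜)‖ ≤
        Real.exp (n * J μ + 19 * (Real.log n + 1)) * supNorm (grid n) p := by
  have hn0 : (0 : ℝ) < n := by exact_mod_cast (by omega : 0 < n)
  have hlog : 0 ≤ Real.log n := Real.log_natCast_nonneg n
  have hl2 : Real.log 2 ≤ 1 := by linarith [Real.log_two_lt_d9]
  have hαn : 0 ≤ α * n := by positivity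
  set m := ⌊α * n⌋₊
  have hm1 : (m : ℝ) ≤ α * n := Nat.floor_le hαn
  have hm2 : α * n < m + 1 := Nat.lt_floor_add_one _
  have hmn : m < n := by
    have : (m : ℝ) < n := by nlinarith
    exact_mod_cast this
  obtain ⟨S, hS, hcard, a, ha, hmin, hswap⟩ := exists_fekete
    (fun j k => Real.log (node n j - node n k))
    (fun j k => by rw [← Real.log_neg_eq_log, neg_sub]) (fun j => by simp) (Finset.range n)
    (m := m) (by simpa using hmn)
  set V := ∑ u ∈ S.erase a, Real.log (node n a - node n u)
  -- The `m` full cells and the fraction `αn - m` of the cell of `a` add up to mass `α`.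
  set w : ℕ → ℝ := fun k => if k = a then α * n - m else 1 with hw
  have hwa : w a = α * n - m := by simp [hw]
  have hwne : ∀ k, k ≠ a → w k = 1 := fun k hk => by simp [hw, hk]
  have hw01 : ∀ k, 0 ≤ w k ∧ w k ≤ 1 := by
    intro k
    rcases eq_or_ne k a with rfl | hk
    · rw [hwa]; constructor <;> linarith
    · rw [hwne k hk]; norm_num
  have hsumw : ∑ k ∈ S, w k = α * n := by
    rw [← Finset.add_sum_erase S w ha, hwa,
      Finset.sum_congr rfl fun k hk => hwne k (Finset.ne_of_mem_erase hk)]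
    simp [Finset.card_erase_of_mem ha, hcard]
  set μ := gridMeasure n S w
  have hμle : μ ≤ sigma := gridMeasure_le_sigma hS fun k _ => (hw01 k).2
  have hμ1 : μ Set.univ = ENNReal.ofReal α := by
    rw [gridMeasure_univ (fun k _ => (hw01 k).1) (fun k _ => (hw01 k).2), hsumw,
      mul_div_cancel_right₀ _ hn0.ne']
  have hrange : ∀ k ∈ S, k < n := fun k hk => Finset.mem_range.mp (hS hk)
  have hU : ∀ x, n * logPotential μ x =
      -(logAvg n a (w a) x + ∑ k ∈ S.erase a, logAvg n k 1 x) := by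
    intro x
    rw [natCast_mul_logPotential_gridMeasure fun k _ => (hw01 k).2,
      ← Finset.add_sum_erase S _ ha]
    congr 2
    exact Finset.sum_congr rfl fun k hk => by rw [hwne k (Finset.ne_of_mem_erase hk)]
  have hErase : S.erase a ⊆ Finset.range n := (Finset.erase_subset a S).trans hS
  have hsupp : ∀ y ∈ (sigma - μ).support,
      -(V + 5 * (Real.log n + 1)) / n ≤ logPotential μ y := by
    intro y hy
    obtain ⟨t, htn, ht, hyt⟩ := support_sigma_sub_gridMeasure_subset hn hS
      (fun k _ => (hw01 k).2) hy
    have ht' : t ∉ S.erase a := by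
      rcases ht with ht | ht
      · exact fun h => ht (Finset.mem_of_mem_erase h)
      · exact fun h => ht (hwne t (Finset.ne_of_mem_erase h))
    have hVt : ∑ u ∈ S.erase a, Real.log (node n t - node n u) ≤ V := by
      rcases eq_or_ne t a with rfl | hta
      · exact le_rfl
      · exact hswap t (Finset.mem_range.mpr htn) fun h => ht' (Finset.mem_erase.mpr ⟨hta, h⟩)
    have h1 : ∑ k ∈ S.erase a, logAvg n k 1 y ≤
        ∑ k ∈ S.erase a, (Real.log (node n t - node n k) + 2 / |(k : ℝ) - t|) :=
      Finset.sum_le_sum fun k hk => logAvg_le_log_node_sub hn (Finset.mem_range.mp (hErase hk))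
        htn (fun h => ht' (h ▸ hk)) hyt
    rw [Finset.sum_add_distrib] at h1
    have h2 := sum_inv_abs_sub_le _ hErase htn
    have h3 := logAvg_le_log_two hn (hrange a ha) (hw01 a).1 (hw01 a).2 (cell_subset_Icc htn hyt)
    rw [div_le_iff₀ hn0, mul_comm (logPotential μ y), hU]
    linarith
  have hne : (sigma - μ).support.Nonempty := by
    refine nonempty_support_sigma_sub hμle ?_
    rw [hμ1, ENNReal.ofReal_lt_one]
    exact hα₁
  have hInf1 : -(V + 5 * (Real.log n + 1)) / n ≤ sInf (logPotential μ '' (sigma - μ).support) :=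
    le_csInf (hne.image _) (Set.forall_mem_image.mpr hsupp)
  -- A real `sInf` over a set unbounded below would be the default `0`.
  have hbdd : BddBelow (logPotential μ '' Set.Icc (-1) 1) := by
    refine ⟨-((m + 1) * Real.log 2) / n, Set.forall_mem_image.mpr fun y hy => ?_⟩
    rw [div_le_iff₀ hn0, mul_comm (logPotential μ y),
      natCast_mul_logPotential_gridMeasure fun k _ => (hw01 k).2, neg_le_neg_iff]
    refine (Finset.sum_le_card_nsmul S _ (Real.log 2) fun k hk =>
      logAvg_le_log_two hn (hrange k hk) (hw01 k).1 (hw01 k).2 hy).trans (le_of_eq ?_)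
    rw [hcard, nsmul_eq_mul]
    push_cast
    rfl
  refine ⟨μ, ⟨hμ1, hμle⟩, fun 𝕜 _ p hp x hx => ?_⟩
  have hInf2 : sInf (logPotential μ '' Set.Icc (-1) 1) ≤ logPotential μ x :=
    csInf_le hbdd ⟨x, hx, rfl⟩
  have hJ : -(V + 5 * (Real.log n + 1)) - n * logPotential μ x ≤ n * J μ := by
    have h1 := (div_le_iff₀ hn0).mp hInf1
    have h2 := mul_le_mul_of_nonneg_left hInf2 hn0.le
    rw [J, mul_sub]
    linarith
  have hdeg : p.natDegree < S.card := by
    rw [hcard]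
    exact Nat.lt_succ_of_le (Nat.le_floor hp)
  have hG : 0 ≤ supNorm (grid n) p :=
    (norm_nonneg _).trans (norm_eval_le_supNorm_grid p (node_mem_grid hn (by omega : 0 < n)))
  refine (norm_eval_le_sum_prod hn hS p hdeg x).trans ?_
  rw [mul_comm]
  gcongr
  -- With `log n + 1` as unit, 18 collects 10 from the numerator, 5 from the support bound, 2 for
  -- exchanging the cells of `s` and `a`, and 1 for the partial cell. The number of terms, at most
  -- `n`, raises it to 19.
  have hterm : ∀ s ∈ S, ∏ u ∈ S.erase s, |x - node n u| / |node n s - node n u| ≤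
      Real.exp (n * J μ + 18 * (Real.log n + 1)) := by
    intro s hs
    have hden : ∏ u ∈ S.erase s, |node n s - node n u| =
        Real.exp (∑ u ∈ S.erase s, Real.log (node n s - node n u)) := by
      rw [Real.exp_sum]
      refine Finset.prod_congr rfl fun u hu => ?_
      rw [← Real.log_abs, Real.exp_log (abs_pos.mpr (sub_ne_zero.mpr fun h =>
        Finset.ne_of_mem_erase hu (node_injective hn h).symm))]
    have hnum := prod_abs_sub_node_le_exp (S.erase s) hn ((Finset.erase_subset s S).trans hS) hx
    rw [Finset.prod_div_distrib, hden, div_le_iff₀ (Real.exp_pos _), ← Real.exp_add]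
    refine hnum.trans (Real.exp_le_exp.mpr ?_)
    have h1 := hmin s hs
    have h2 := Finset.add_sum_erase S (fun k => logAvg n k 1 x) hs
    have h3 := Finset.add_sum_erase S (fun k => logAvg n k 1 x) ha
    have h4 := logAvg_le_log_two hn (hrange a ha) zero_le_one le_rfl hx
    have h5 := neg_log_le_logAvg (k := s) (x := x) hn zero_le_one le_rfl
    have h6 := neg_log_le_logAvg (k := a) (x := x) hn (hw01 a).1 (hw01 a).2
    have h7 := hU x
    linarith
  refine (Finset.sum_le_card_nsmul S _ _ hterm).trans ?_
  have hSn : (S.card : ℝ) ≤ n := by rw [hcard]; exact_mod_cast hmn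
  calc S.card • Real.exp (n * J μ + 18 * (Real.log n + 1))
      ≤ Real.exp (Real.log n) * Real.exp (n * J μ + 18 * (Real.log n + 1)) := by
        rw [nsmul_eq_mul, Real.exp_log hn0]; gcongr
    _ ≤ Real.exp (n * J μ + 19 * (Real.log n + 1)) := by
        rw [← Real.exp_add, Real.exp_le_exp]; linarith

theorem log_normRatio_le {𝕜 : Type*} [RCLike 𝕜] {α : ℝ} (hα₀ : 0 < α) (hα₁ : α < 1) {n : ℕ}
    (hn : 2 ≤ n) {p : 𝕜[X]} (hp : p ∈ admissible 𝕜 α n) :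
    ∃ μ ∈ classM α,
      1 / (n : ℝ) * Real.log (normRatio n p) ≤ J μ + 19 * (Real.log n + 1) / n := by
  obtain ⟨μ, hμ, h⟩ := exists_measure_norm_eval_le hα₀ hα₁ hn
  refine ⟨μ, hμ, ?_⟩
  have hn0 : (0 : ℝ) < n := by exact_mod_cast (by omega : 0 < n)
  have hle : supNorm (Set.Icc (-1) 1) p ≤
      Real.exp (n * J μ + 19 * (Real.log n + 1)) * supNorm (grid n) p :=
    csSup_le ((Set.nonempty_Icc.mpr (by norm_num)).image _)
      (Set.forall_mem_image.mpr fun x hx => h 𝕜 p hp.2 x hx)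
  have hpos := supNorm_Icc_pos hp.1
  -- If the grid norm vanished, the bound just obtained would force `p` to vanish on `[-1,1]`.
  have hgpos : 0 < supNorm (grid n) p := pos_of_mul_pos_right (hpos.trans_le hle) (by positivity)
  have hlog : Real.log (normRatio n p) ≤ n * J μ + 19 * (Real.log n + 1) := by
    rw [normRatio, Real.log_le_iff_le_exp (div_pos hpos hgpos)]
    exact (div_le_iff₀ hgpos).mpr hle
  rw [one_div, ← div_eq_inv_mul, div_le_iff₀ hn0, add_mul, div_mul_cancel₀ _ hn0.ne']
  linarith

theorem tendsto_log_add_one_div_natCast :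
    Tendsto (fun n : ℕ => 19 * (Real.log n + 1) / (n : ℝ)) atTop (nhds 0) := by
  have h1 : Tendsto (fun x : ℝ => Real.log x / x) atTop (nhds 0) := by
    simpa using Real.isLittleO_log_id_atTop.tendsto_div_nhds_zero
  have h2 := ((h1.add tendsto_inv_atTop_zero).const_mul 19).comp tendsto_natCast_atTop_atTop
  simp only [add_zero, mul_zero] at h2
  refine h2.congr fun n => ?_
  simp only [Function.comp]
  ring

end GridPoly

theorem proposition3p2 {𝕜 : Type*} [RCLike 𝕜] (α : ℝ) (hα₀ : 0 < α) (hα₁ : α < 1)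
    (p : ℕ → Polynomial 𝕜) (hp : ∀ n : ℕ, 2 ≤ n → GridPoly.IsExtremal α n (p n)) :
    Filter.limsup
        (fun n : ℕ =>
          (((1 / (n : ℝ)) *
            Real.log (GridPoly.supNorm (Set.Icc (-1) 1) (p n) /
              GridPoly.supNorm (GridPoly.grid n) (p n)) : ℝ) : EReal))
        Filter.atTop
      ≤ ⨆ μ ∈ GridPoly.classM α, ((GridPoly.J μ : ℝ) : EReal) := by
  set L : EReal := ⨆ μ ∈ GridPoly.classM α, ((GridPoly.J μ : ℝ) : EReal) with hL
  have hbound : ∀ᶠ n : ℕ in Filter.atTop,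
      (((1 / (n : ℝ)) * Real.log (GridPoly.supNorm (Set.Icc (-1) 1) (p n) /
        GridPoly.supNorm (GridPoly.grid n) (p n)) : ℝ) : EReal) ≤
      L + ((19 * (Real.log n + 1) / (n : ℝ) : ℝ) : EReal) := by
    filter_upwards [Filter.eventually_ge_atTop 2] with n hn
    obtain ⟨μ, hμ, h⟩ := GridPoly.log_normRatio_le hα₀ hα₁ hn (hp n hn).1
    calc _ ≤ ((GridPoly.J μ + 19 * (Real.log n + 1) / n : ℝ) : EReal) :=
        EReal.coe_le_coe_iff.mpr h
      _ = (GridPoly.J μ : EReal) + ((19 * (Real.log n + 1) / (n : ℝ) : ℝ) : EReal) :=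
        EReal.coe_add _ _
      _ ≤ _ := by
        gcongr
        exact le_iSup₂_of_le μ hμ le_rfl
  have herr : Filter.Tendsto (fun n : ℕ => L + ((19 * (Real.log n + 1) / (n : ℝ) : ℝ) : EReal))
      Filter.atTop (nhds L) := by
    have h := (EReal.tendsto_coe.mpr GridPoly.tendsto_log_add_one_div_natCast)
    -- Addition is continuous at `(L, 0)` even for infinite `L`, because the second entry is finite.
    have h2 := (EReal.continuousAt_add (p := (L, ((0 : ℝ) : EReal)))
      (by simp) (by simp)).tendsto.comp (tendsto_const_nhds.prodMk_nhds h)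
    simp only [EReal.coe_zero, add_zero] at h2
    exact h2
  exact (Filter.limsup_le_limsup hbound).trans herr.limsup_eq.le
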